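/- **Setting.** Let $T>0$, $1\le d\le D$, and let $(\Omega,(\mathcal F_t)_{t\in[0,T]},P)$ be a filtered probability space satisfying the usual conditions. Write $\mathbb R^n_+$ for the non-negative orthant of $\mathbb R^n$ and $\mathbf 1=(1,\dots,1)\in\mathbb R^D$. A bid-ask matrix is a $D\times D$ matrix $\Pi=(\pi^{ij})$ with $\pi^{ij}>0$, $\pi^{ii}=1$ and $\pi^{ij}\le\pi^{ik}\pi^{kj}$; its solvency cone $K(\Pi)\subseteq\mathbb R^D$ is the convex cone generated by the vectors $e^i$ and $\pi^{ij}e^i-e^j$ ($1\le i,j\le D$), and $K^*(\Pi)=\{w:\langle v,w\rangle\ge0\ \forall v\in K(\Pi)\}$. Let $(\Pi_t)_{t\in[0,T]}$ be an adapted càdlàg process of bid-ask matrices, $K_t=K(\Pi_t)$, $K_{t-}=K(\Pi_{t-})$, and assume $\mathcal F_{T-}=\mathcal F_T$ and $\Pi_{T-}=\Pi_T$ a.s. (Left limits at time $0$ are understood as values at time $0$.) A strictly consistent price process is an $\mathbb R^D_+\setminus\{0\}$-valued càdlàg martingale $Z$ with $Z_t\in K_t^*$ a.s. for every $t$, such that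 $Z_\tau\in\operatorname{int}K_\tau^*$ a.s. on $\{\tau<\infty\}$ for every $[0,T]\cup\{\infty\}$-valued stopping time $\tau$, and $Z_{\sigma-}\in\operatorname{int}K_{\sigma-}^*$ a.s. on $\{\sigma<\infty\}$ for every predictable such $\sigma$. Assume that at least one such process exists. For $x\in\mathbb R^D$ let $\mathcal A^x$ be the set of $\mathbb R^D$-valued predictable processes $V=(V_t)_{t\in[0,T]}$ with $V_0=x$ a.s. and a.e. path of finite variation such that * for all stopping times $0\le\sigma\le\tau\le T$, $V_\tau-V_\sigma\in-\overline{\operatorname{conv}}\big(\bigcup_{\sigma\le t<\tau}K_t\cup\{0\}\big)$ a.s.; * there is $a>0$ with $V_T+a\mathbf 1\in K_T$ a.s. and $\langle V_\tau+a\mathbf 1,Z_\tau\rangle\ge0$ a.s. for all $[0,T]$-valued stopping times $\tau$ and all strictly consistent price processes $Z$. Let $\mathcal A^x_T=\{V_T:V\in\mathcal A^x\}$ and $\mathcal A^x_{T-}=\{V_{T-}:V\in\mathcal A^x\}$. **Preferences.** Let $U:\mathbb R^d\to[-\infty,\infty)$ be concave and not identically $-\infty$, with effective domain $\operatorname{dom}U=\{U>-\infty\}$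 satisfying $\overline{\operatorname{dom}U}=\mathbb R^d_+$, and increasing: $U(x')\ge U(x)$ whenever $x'-x\in\mathbb R^d_+$. Assume that $U$ is upper semi-continuous, strictly concave on $\operatorname{int}\mathbb R^d_+$, essentially smooth (differentiable in $\operatorname{int}(\operatorname{dom}U)$, with $|\nabla U(x_k)|\to\infty$ whenever $x_k\in\operatorname{int}(\operatorname{dom}U)$ converges to a boundary point of $\operatorname{int}(\operatorname{dom}U)$), and asymptotically satiable (for every $\varepsilon>0$ some superdifferential $\partial(\operatorname{cl}U)(x)$, where $\operatorname{cl}U$ is the function whose hypograph is the closure of that of $U$, meets $[0,\varepsilon)^d$). Put $\tilde U(x)=U(x_1,\dots,x_d)$ for $x\in\mathbb R^D_+$ and $\tilde U(x)=-\infty$ otherwise. Expectations of $[-\infty,\infty)$-valued variables are $E[f]=E[f^+]-E[f^-]$, with $E[f]=-\infty$ whenever $E[f^-]=\infty$. Define the value function $$u(x)=\sup_{X\in\mathcal A^x_T}E[\tilde U(X)],$$ and, for a random portfolio $W$, the terminal liquidation utility $$\bar U(W)=\sup\{U(\xi):\ \xi\in\mathbb R^d_+,\ (\xi,\underline 0)-W\in-K_T\},\qquad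 \sup\emptyset=-\infty,$$ where $\underline 0$ is the zero vector in $\mathbb R^{D-d}$. **Proposition.** For almost every $\omega$, the supremum defining the liquidation utility is a maximum for every portfolio in $K_T(\omega)$; in particular $\bar U(W)$ is a.s. a maximum whenever $W\in K_T$ a.s. Moreover, for every $x\in\mathbb R^D$, $$u(x)=\sup_{W\in\mathcal A^x_{T-}}E[\bar U(W)].$$ -/

import Mathlib

open MeasureTheory Set Filter Topology
open scoped NNReal ENNReal Matrix

noncomputable section

/-- The time interval `[0, T]`; `⊥` is time `0` and `⊤` is time `T`. -/
abbrev TimeInterval (T : ℝ≥0) : Type := Set.Iic T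

/-- Vectors of `n` assets or goods, in physical units. -/
abbrev Vec (n : ℕ) : Type := EuclideanSpace ℝ (Fin n)

/-- The non-negative orthant. -/
def orthant (n : ℕ) : Set (Vec n) := {x | ∀ i, 0 ≤ x i}

/-- The coordinatewise order embedding `ξ ↦ (ξ, 0)`. -/
def padZero (d D : ℕ) (ξ : Vec d) : Vec D :=
  WithLp.toLp 2 fun i : Fin D => if h : (i : ℕ) < d then ξ ⟨i, h⟩ else 0

/-- The projection `x ↦ (x₁, …, x_d)` onto the first `d` coordinates. -/
def projFirst {d D : ℕ} (hdD : d ≤ D) (x : Vec D) : Vec d :=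
  WithLp.toLp 2 fun i : Fin d => x (Fin.castLE hdD i)

/-- The vector all of whose entries are `1`. -/
def onesVec (D : ℕ) : Vec D := WithLp.toLp 2 fun _ => 1

/-! ### Concave functions and multivariate utility functions -/

section Utility

variable {n : ℕ}

/-- The hypograph of an extended-real-valued function. -/
def hypograph (U : Vec n → EReal) : Set (Vec n × ℝ) := {p | (p.2 : EReal) ≤ U p.1}

/-- The effective domain `{U > -∞}`. -/
def effDom (U : Vec n → EReal) : Set (Vec n) := {x | ⊥ < U x}

/-- A concave function with non-empty effective domain which never takes the value `+∞`. -/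
structure IsProperConcave (U : Vec n → EReal) : Prop where
  convex_hypograph : Convex ℝ (hypograph U)
  nonempty_effDom : (effDom U).Nonempty
  ne_top : ∀ x, U x ≠ ⊤

/-- `C` is a convex cone (containing the origin): `λ C + μ C ⊆ C` for all `λ, μ ≥ 0`. -/
def IsConvexCone (C : Set (Vec n)) : Prop :=
  ∀ a b : ℝ, 0 ≤ a → 0 ≤ b → ∀ x ∈ C, ∀ y ∈ C, a • x + b • y ∈ C

/-- A multivariate utility function, with support cone `closure (effDom U)`. -/
structure IsUtility (U : Vec n → EReal) : Prop extends IsProperConcave U where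
  isConvexCone_support : IsConvexCone (closure (effDom U))
  orthant_subset_support : orthant n ⊆ closure (effDom U)
  support_ne_univ : closure (effDom U) ≠ univ
  increasing : ∀ x x', x' - x ∈ closure (effDom U) → U x ≤ U x'

/-- The closure of a function: the function whose hypograph is the closure of the hypograph. -/
def closureFun (U : Vec n → EReal) (x : Vec n) : EReal :=
  ⨆ (r : ℝ) (_ : (x, r) ∈ closure (hypograph U)), (r : EReal)

/-- The superdifferential of `U` at `x`. -/
def superdifferential (U : Vec n → EReal) (x : Vec n) : Set (Vec n) :=
  {p | ∀ z, U z ≤ U x + ((inner ℝ (z - x) p : ℝ) : EReal)}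

/-- Essential smoothness: `U` is differentiable in the non-empty interior of its effective domain,
and the norm of its gradient diverges at the boundary. -/
structure IsEssentiallySmooth (U : Vec n → EReal) : Prop where
  nonempty_interior : (interior (effDom U)).Nonempty
  differentiableAt : ∀ x ∈ interior (effDom U), DifferentiableAt ℝ (fun y => (U y).toReal) x
  gradient_diverges : ∀ (s : ℕ → Vec n) (b : Vec n), (∀ k, s k ∈ interior (effDom U)) →
    b ∈ frontier (interior (effDom U)) → Tendsto s atTop (𝓝 b) →
    Tendsto (fun k => ‖gradient (fun y => (U y).toReal) (s k)‖) atTop atTop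

/-- Asymptotic satiability: marginal utilities can be made arbitrarily small. -/
def IsAsymptoticallySatiable (U : Vec n → EReal) : Prop :=
  ∀ ε : ℝ, 0 < ε → ∃ x, ∃ p ∈ superdifferential (closureFun U) x, ∀ i, 0 ≤ p i ∧ p i < ε

/-- The investor's preferences: a utility function supported on the non-negative orthant, which is
upper semi-continuous, strictly concave in the interior of the orthant, essentially smooth and
asymptotically satiable. -/
structure IsInvestorUtility (U : Vec n → EReal) : Prop extends IsUtility U where
  support_eq : closure (effDom U) = orthant n
  upperSemicontinuous : UpperSemicontinuous U
  strictConcaveOn : StrictConcaveOn ℝ (interior (orthant n)) fun x => (U x).toReal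
  essentiallySmooth : IsEssentiallySmooth U
  asymptoticallySatiable : IsAsymptoticallySatiable U

open Classical in
/-- The extension of `U` to all `D` assets: `U (x₁, …, x_d)` on the non-negative orthant of `ℝ^D`
and `-∞` elsewhere. -/
def extendUtility {D : ℕ} (hnD : n ≤ D) (U : Vec n → EReal) (x : Vec D) : EReal :=
  if x ∈ orthant D then U (projFirst hnD x) else ⊥

end Utility

open Classical in
/-- The expectation `E[f⁺] - E[f⁻]` of an extended-real-valued random variable, with the convention
that it is `-∞` whenever `E[f⁻] = ∞`. -/
def expectation {Ω : Type*} [MeasurableSpace Ω] (P : Measure Ω) (f : Ω → EReal) : EReal :=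
  if ∫⁻ ω, (-f ω).toENNReal ∂P = ⊤ then ⊥
  else ((∫⁻ ω, (f ω).toENNReal ∂P : ℝ≥0∞) : EReal) - ((∫⁻ ω, (-f ω).toENNReal ∂P : ℝ≥0∞) : EReal)

/-! ### Bid-ask matrices and solvency cones -/

section BidAsk

variable {D : ℕ}

/-- `M i j` is the number of units of asset `i` required to purchase one unit of asset `j`. -/
structure IsBidAskMatrix (M : Matrix (Fin D) (Fin D) ℝ) : Prop where
  pos : ∀ i j, 0 < M i j
  diag : ∀ i, M i i = 1
  triangle : ∀ i j k, M i j ≤ M i k * M k j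

/-- The solvency cone: the convex cone generated by the vectors `e^i` and `π^{ij} e^i - e^j`. -/
def solvencyCone (M : Matrix (Fin D) (Fin D) ℝ) : Set (Vec D) :=
  (PointedCone.hull ℝ
    ((range fun i : Fin D => (EuclideanSpace.single i (1 : ℝ) : Vec D)) ∪
      (range fun p : Fin D × Fin D =>
        M p.1 p.2 • (EuclideanSpace.single p.1 (1 : ℝ) : Vec D) -
          EuclideanSpace.single p.2 (1 : ℝ))) : Set (Vec D))

/-- The positive polar cone of the solvency cone. -/
def polarCone (M : Matrix (Fin D) (Fin D) ℝ) : Set (Vec D) :=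
  {w | ∀ v ∈ solvencyCone M, 0 ≤ (inner ℝ v w : ℝ)}

end BidAsk

/-- Right-continuity with existence of left limits. -/
def IsCadlagPath {T : ℝ≥0} {E : Type*} [TopologicalSpace E] (f : TimeInterval T → E) : Prop :=
  ∀ t, ContinuousWithinAt f (Ici t) t ∧ ∃ l, Tendsto f (𝓝[<] t) (𝓝 l)

/-! ### The market model

`𝓕` is the filtration, `P` the probability measure, `Pi` the bid-ask process.  Left limits are
`Function.leftLim`, which at time `0` returns the value at time `0`. -/

section Market

variable {Ω : Type*} [mΩ : MeasurableSpace Ω] {T : ℝ≥0} {D : ℕ}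

/-- The usual conditions: `𝓕` is right-continuous and `𝓕 0` contains all subsets of null sets
(`P s = 0` refers to the outer measure, so `s` is not assumed to be measurable). -/
structure SatisfiesUsualConditions (𝓕 : Filtration (TimeInterval T) mΩ) (P : Measure Ω) :
    Prop where
  rightContinuous : 𝓕.IsRightContinuous
  complete : ∀ s : Set Ω, P s = 0 → MeasurableSet[𝓕 ⊥] s

/-- An adapted càdlàg process with values in the set of bid-ask matrices. -/
structure IsBidAskProcess (𝓕 : Filtration (TimeInterval T) mΩ)
    (Pi : TimeInterval T → Ω → Matrix (Fin D) (Fin D) ℝ) : Prop where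
  bidAsk : ∀ t ω, IsBidAskMatrix (Pi t ω)
  adapted : StronglyAdapted 𝓕 Pi
  cadlag : ∀ ω, IsCadlagPath fun t => Pi t ω

/-- There is no new information and no price jump at time `T`:
`𝓕_{T-} = 𝓕_T` and `Π_{T-} = Π_T` a.s. -/
structure NoFinalJump (𝓕 : Filtration (TimeInterval T) mΩ) (P : Measure Ω)
    (Pi : TimeInterval T → Ω → Matrix (Fin D) (Fin D) ℝ) : Prop where
  filtration_eq : (⨆ (t : TimeInterval T) (_ : t < ⊤), 𝓕 t) = 𝓕 ⊤
  price_eq : ∀ᵐ ω ∂P, Function.leftLim (fun t => Pi t ω) ⊤ = Pi ⊤ ω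

/-- A predictable `[0, T] ∪ {∞}`-valued stopping time: its graph is a predictable set. -/
structure IsPredictableStoppingTime (𝓕 : Filtration (TimeInterval T) mΩ)
    (σ : Ω → WithTop (TimeInterval T)) : Prop where
  isStoppingTime : IsStoppingTime 𝓕 σ
  measurableSet_graph : MeasurableSet[𝓕.predictable] {p : TimeInterval T × Ω | σ p.2 = p.1}

/-- A consistent price process. -/
structure IsConsistentPriceProcess (𝓕 : Filtration (TimeInterval T) mΩ) (P : Measure Ω)
    (Pi : TimeInterval T → Ω → Matrix (Fin D) (Fin D) ℝ) (Z : TimeInterval T → Ω → Vec D) :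
    Prop where
  mem_orthant : ∀ t ω, Z t ω ∈ orthant D \ {0}
  cadlag : ∀ ω, IsCadlagPath fun t => Z t ω
  martingale : Martingale Z 𝓕 P
  mem_polarCone : ∀ t, ∀ᵐ ω ∂P, Z t ω ∈ polarCone (Pi t ω)

/-- A strictly consistent price process. -/
structure IsStrictlyConsistentPriceProcess (𝓕 : Filtration (TimeInterval T) mΩ) (P : Measure Ω)
    (Pi : TimeInterval T → Ω → Matrix (Fin D) (Fin D) ℝ) (Z : TimeInterval T → Ω → Vec D) :
    Prop extends IsConsistentPriceProcess 𝓕 P Pi Z where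
  strict : ∀ τ : Ω → WithTop (TimeInterval T), IsStoppingTime 𝓕 τ →
    ∀ᵐ ω ∂P, ∀ t : TimeInterval T, τ ω = t → Z t ω ∈ interior (polarCone (Pi t ω))
  strict_left : ∀ σ : Ω → WithTop (TimeInterval T), IsPredictableStoppingTime 𝓕 σ →
    ∀ᵐ ω ∂P, ∀ t : TimeInterval T, σ ω = t →
      Function.leftLim (fun s => Z s ω) t ∈
        interior (polarCone (Function.leftLim (fun s => Pi s ω) t))

/-- A self-financing portfolio process. -/
structure IsSelfFinancing (𝓕 : Filtration (TimeInterval T) mΩ) (P : Measure Ω)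
    (Pi : TimeInterval T → Ω → Matrix (Fin D) (Fin D) ℝ) (V : TimeInterval T → Ω → Vec D) :
    Prop where
  predictable : IsStronglyPredictable 𝓕 V
  finiteVariation : ∀ᵐ ω ∂P, BoundedVariationOn (fun t => V t ω) univ
  selfFinancing : ∀ σ τ : Ω → TimeInterval T,
    IsStoppingTime 𝓕 (fun ω => (σ ω : WithTop (TimeInterval T))) →
    IsStoppingTime 𝓕 (fun ω => (τ ω : WithTop (TimeInterval T))) →
    (∀ ω, σ ω ≤ τ ω) →
    ∀ᵐ ω ∂P, -(V (τ ω) ω - V (σ ω) ω) ∈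
      closure (convexHull ℝ ((⋃ t ∈ Ico (σ ω) (τ ω), solvencyCone (Pi t ω)) ∪ {0}))

/-- An admissible self-financing portfolio process. -/
structure IsAdmissible (𝓕 : Filtration (TimeInterval T) mΩ) (P : Measure Ω)
    (Pi : TimeInterval T → Ω → Matrix (Fin D) (Fin D) ℝ) (V : TimeInterval T → Ω → Vec D) :
    Prop extends IsSelfFinancing 𝓕 P Pi V where
  bounded_below : ∃ a : ℝ, 0 < a ∧
    (∀ᵐ ω ∂P, V ⊤ ω + a • onesVec D ∈ solvencyCone (Pi ⊤ ω)) ∧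
    ∀ τ : Ω → TimeInterval T,
      IsStoppingTime 𝓕 (fun ω => (τ ω : WithTop (TimeInterval T))) →
      ∀ Z, IsStrictlyConsistentPriceProcess 𝓕 P Pi Z →
      ∀ᵐ ω ∂P, 0 ≤ (inner ℝ (V (τ ω) ω + a • onesVec D) (Z (τ ω) ω) : ℝ)

/-- The admissible self-financing portfolio processes with initial endowment `x`. -/
def admissiblePortfolios (𝓕 : Filtration (TimeInterval T) mΩ) (P : Measure Ω)
    (Pi : TimeInterval T → Ω → Matrix (Fin D) (Fin D) ℝ) (x : Vec D) :
    Set (TimeInterval T → Ω → Vec D) :=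
  {V | IsAdmissible 𝓕 P Pi V ∧ ∀ᵐ ω ∂P, V ⊥ ω = x}

/-- The terminal values `V_T` of admissible portfolio processes with initial endowment `x`. -/
def terminalPortfolios (𝓕 : Filtration (TimeInterval T) mΩ) (P : Measure Ω)
    (Pi : TimeInterval T → Ω → Matrix (Fin D) (Fin D) ℝ) (x : Vec D) : Set (Ω → Vec D) :=
  {X | ∃ V ∈ admissiblePortfolios 𝓕 P Pi x, X = V ⊤}

/-- The pre-terminal values `V_{T-}` of admissible portfolio processes with initial endowment `x`.
The left limit exists for almost every `ω`, since paths have finite variation. -/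
def preTerminalPortfolios (𝓕 : Filtration (TimeInterval T) mΩ) (P : Measure Ω)
    (Pi : TimeInterval T → Ω → Matrix (Fin D) (Fin D) ℝ) (x : Vec D) : Set (Ω → Vec D) :=
  {W | ∃ V ∈ admissiblePortfolios 𝓕 P Pi x,
    W = fun ω => Function.leftLim (fun t => V t ω) ⊤}

/-- The value function `u` of the investor's primal problem. -/
def valueFunction (𝓕 : Filtration (TimeInterval T) mΩ) (P : Measure Ω)
    (Pi : TimeInterval T → Ω → Matrix (Fin D) (Fin D) ℝ) {d : ℕ} (hdD : d ≤ D)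
    (U : Vec d → EReal) (x : Vec D) : EReal :=
  ⨆ X ∈ terminalPortfolios 𝓕 P Pi x, expectation P fun ω => extendUtility hdD U (X ω)

end Market

/-! ### Liquidation -/

/-- The consumption bundles in the first `d` goods into which the portfolio `w` can be liquidated
when the bid-ask matrix is `M`. -/
def liquidationSet (d : ℕ) {D : ℕ} (M : Matrix (Fin D) (Fin D) ℝ) (w : Vec D) : Set (Vec d) :=
  {ξ | ξ ∈ orthant d ∧ -(padZero d D ξ - w) ∈ solvencyCone M}

/-- The liquidation utility of the portfolio `w` when the bid-ask matrix is `M`.  It is `-∞` if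
`w` cannot be liquidated, i.e. if `w` is not solvent. -/
def liquidationUtility {d D : ℕ} (U : Vec d → EReal) (M : Matrix (Fin D) (Fin D) ℝ)
    (w : Vec D) : EReal :=
  ⨆ ξ ∈ liquidationSet d M w, U ξ

end

/-! Since prices do not jump at `T`, a trade at `T` is available just before `T` up to closure, and
conversely. A strictly consistent price process puts a point `z` in `int K_T^*` a.s.; pairing with
`z` makes `K_T` closed and liquidation sets compact, so an upper semicontinuous `U` attains its
maximum.

For `≤`, the final trade `V_{T-} - V_T` lies in `K_T`, because the cones `K_t` cannot grow in the
limit `t → T` (`mem_solvencyCone_of_tendsto`). Discarding the last `D - d` assets is also solvent,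
so `V_T` yields at most the liquidation utility of `V_{T-}`.

For `≥`, if `V_{T-}` is insolvent with positive probability, its expected liquidation utility is
`-∞`. Otherwise an optimal bundle `ξ` is chosen measurably (`exists_measurable_liquidation`) and
`V_T` is replaced by `(ξ, 0)`. The result is predictable because `𝓕_{T-} = 𝓕_T`, and self-financing
because every point of `K_T` is a limit of points of `K_t` (`solvencyCone_subset_of_tendsto`); this
is `IsAdmissible.update_top`. -/

/-! ### Solvency cones: closedness and semicontinuity in the bid-ask matrix. -/

section Cones

variable {D : ℕ}

/-- The generators of the solvency cone. -/
noncomputable def solvencyGen (M : Matrix (Fin D) (Fin D) ℝ) : Fin D ⊕ (Fin D × Fin D) → Vec D :=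
  Sum.elim (fun i => EuclideanSpace.single i (1 : ℝ))
    (fun p => M p.1 p.2 • (EuclideanSpace.single p.1 (1 : ℝ) : Vec D) -
      EuclideanSpace.single p.2 (1 : ℝ))

lemma mem_solvencyCone_iff {M : Matrix (Fin D) (Fin D) ℝ} {v : Vec D} :
    v ∈ solvencyCone M ↔
      ∃ c : Fin D ⊕ (Fin D × Fin D) → ℝ, 0 ≤ c ∧ ∑ k, c k • solvencyGen M k = v := by
  rw [solvencyCone, ← Sum.elim_range, SetLike.mem_coe, PointedCone.hull,
    Submodule.mem_span_range_iff_exists_fun]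
  constructor
  · rintro ⟨c, hc⟩
    exact ⟨fun k => c k, fun k => (c k).2, hc⟩
  · rintro ⟨c, hc, h⟩
    exact ⟨fun k => ⟨c k, hc k⟩, h⟩

lemma solvencyGen_mem (M : Matrix (Fin D) (Fin D) ℝ) (k) : solvencyGen M k ∈ solvencyCone M := by
  classical
  refine mem_solvencyCone_iff.2 ⟨Pi.single k 1, ?_, ?_⟩
  · exact Pi.single_nonneg.2 zero_le_one
  · rw [Finset.sum_eq_single k] <;> simp +contextual

lemma add_mem_solvencyCone {M : Matrix (Fin D) (Fin D) ℝ} {v w : Vec D}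
    (hv : v ∈ solvencyCone M) (hw : w ∈ solvencyCone M) : v + w ∈ solvencyCone M :=
  Submodule.add_mem (PointedCone.hull ℝ _) hv hw

lemma smul_mem_solvencyCone {M : Matrix (Fin D) (Fin D) ℝ} {v : Vec D} {a : ℝ} (ha : 0 ≤ a)
    (hv : v ∈ solvencyCone M) : a • v ∈ solvencyCone M := by
  obtain ⟨c, hc, rfl⟩ := mem_solvencyCone_iff.1 hv
  refine mem_solvencyCone_iff.2 ⟨a • c, smul_nonneg ha hc, ?_⟩
  simp [Finset.smul_sum, mul_smul]

lemma orthant_subset_solvencyCone (M : Matrix (Fin D) (Fin D) ℝ) :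
    orthant D ⊆ solvencyCone M := by
  intro x hx
  refine mem_solvencyCone_iff.2 ⟨Sum.elim x 0, ?_, ?_⟩
  · rintro (i | p)
    · exact hx i
    · exact le_rfl
  · ext j
    simp [solvencyGen, Finset.sum_apply, Pi.single_apply]

lemma mem_polarCone_iff {M : Matrix (Fin D) (Fin D) ℝ} {w : Vec D} :
    w ∈ polarCone M ↔ ∀ k, 0 ≤ (inner ℝ (solvencyGen M k) w : ℝ) := by
  refine ⟨fun h k => h _ (solvencyGen_mem M k), fun h v hv => ?_⟩
  obtain ⟨c, hc, rfl⟩ := mem_solvencyCone_iff.1 hv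
  rw [sum_inner]
  refine Finset.sum_nonneg fun k _ => ?_
  rw [real_inner_smul_left]
  exact mul_nonneg (hc k) (h k)

lemma continuous_solvencyGen (k : Fin D ⊕ (Fin D × Fin D)) :
    Continuous fun M : Matrix (Fin D) (Fin D) ℝ => solvencyGen M k := by
  rcases k with i | p
  · exact continuous_const
  · simp only [solvencyGen, Sum.elim_inr]
    exact ((continuous_id.matrix_elem p.1 p.2).smul continuous_const).sub continuous_const

/-- For small `δ > 0` the vector `z - δ v` is still polar, and pairing it with `v` gives `⟨v, z⟩ ≥ δ
‖v‖²`. -/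
lemma inner_pos_of_mem_interior_polarCone {M : Matrix (Fin D) (Fin D) ℝ} {z v : Vec D}
    (hz : z ∈ interior (polarCone M)) (hv : v ∈ solvencyCone M) (hv0 : v ≠ 0) :
    0 < (inner ℝ v z : ℝ) := by
  have hc : Tendsto (fun δ : ℝ => z - δ • v) (𝓝[>] 0) (𝓝 z) := by
    refine Tendsto.mono_left ?_ nhdsWithin_le_nhds
    have : Continuous fun δ : ℝ => z - δ • v := by fun_prop
    simpa using this.tendsto 0
  obtain ⟨δ, hδ, hδ0⟩ :=
    ((hc.eventually (mem_interior_iff_mem_nhds.1 hz)).and self_mem_nhdsWithin).exists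
  have h := hδ v hv
  rw [inner_sub_right, real_inner_smul_right, real_inner_self_eq_norm_sq] at h
  have : 0 < δ * ‖v‖ ^ 2 := mul_pos hδ0 (by positivity)
  linarith

/-- Pairing with `z` bounds the coefficient of every nonzero generator, so near any point the cone
lies in the image of a compact box of coefficients, itself contained in the cone. -/
lemma isClosed_solvencyCone {M : Matrix (Fin D) (Fin D) ℝ} {z : Vec D}
    (hz : z ∈ interior (polarCone M)) : IsClosed (solvencyCone M) := by
  refine isClosed_of_closure_subset fun x hx => ?_
  set R : ℝ := (‖x‖ + 1) * ‖z‖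
  set B : Fin D ⊕ (Fin D × Fin D) → ℝ := fun k => R / inner ℝ (solvencyGen M k) z
  set f : (Fin D ⊕ (Fin D × Fin D) → ℝ) → Vec D := fun c => ∑ k, c k • solvencyGen M k
  have hf : Continuous f := by fun_prop
  have hcl : IsClosed (f '' Icc 0 B) := (isCompact_Icc.image hf).isClosed
  have hsub : solvencyCone M ∩ Metric.ball x 1 ⊆ f '' Icc 0 B := by
    rintro v ⟨hv, hvx⟩
    obtain ⟨c, hc, rfl⟩ := mem_solvencyCone_iff.1 hv
    classical
    -- Zero generators impose no bound; their coefficients are reset to `0`, matching `B k = R / 0 =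
    -- 0`.
    refine ⟨fun k => if solvencyGen M k = 0 then 0 else c k, ⟨fun k => ?_, fun k => ?_⟩, ?_⟩
    · dsimp only
      split_ifs
      exacts [le_rfl, hc k]
    · dsimp only [B]
      split_ifs with h0
      · simp [h0]
      · have hpos := inner_pos_of_mem_interior_polarCone hz (solvencyGen_mem M k) h0
        rw [le_div_iff₀ hpos, ← real_inner_smul_left]
        calc (inner ℝ (c k • solvencyGen M k) z : ℝ)
            ≤ ∑ k, inner ℝ (c k • solvencyGen M k) z :=
              Finset.single_le_sum (f := fun k => (inner ℝ (c k • solvencyGen M k) z : ℝ))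
                (fun j _ => interior_subset hz _
                  (smul_mem_solvencyCone (hc j) (solvencyGen_mem M j))) (Finset.mem_univ k)
          _ = inner ℝ (∑ k, c k • solvencyGen M k) z := (sum_inner _ _ _).symm
          _ ≤ ‖∑ k, c k • solvencyGen M k‖ * ‖z‖ := real_inner_le_norm _ _
          _ ≤ R := by
              refine mul_le_mul_of_nonneg_right ?_ (norm_nonneg _)
              rw [Metric.mem_ball, dist_eq_norm] at hvx
              have := norm_le_norm_add_norm_sub' (∑ k, c k • solvencyGen M k) x
              linarith
    · refine Finset.sum_congr rfl fun k _ => ?_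
      dsimp only
      split_ifs with h0
      · simp [h0]
      · rfl
  have hx' : x ∈ closure (solvencyCone M ∩ Metric.ball x 1) := by
    rw [Metric.mem_closure_iff] at hx ⊢
    intro ε hε
    obtain ⟨b, hb, hd⟩ := hx (min ε 1) (by positivity)
    exact ⟨b, ⟨hb, by rw [Metric.mem_ball, dist_comm]; exact hd.trans_le (min_le_right _ _)⟩,
      hd.trans_le (min_le_left _ _)⟩
  obtain ⟨c, hc, rfl⟩ := (hcl.closure_subset_iff.2 hsub) hx'
  exact mem_solvencyCone_iff.2 ⟨c, hc.1, rfl⟩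

/-- A vector that pairs non-negatively with the polar cone of a closed solvency cone is solvent. -/
lemma mem_solvencyCone_of_forall_polarCone {M : Matrix (Fin D) (Fin D) ℝ}
    (hM : IsClosed (solvencyCone M)) {y : Vec D}
    (hy : ∀ w ∈ polarCone M, 0 ≤ (inner ℝ y w : ℝ)) : y ∈ solvencyCone M := by
  by_contra hyK
  let C : ProperCone ℝ (Vec D) := ⟨PointedCone.hull ℝ _, hM⟩
  obtain ⟨w, hw, hlt⟩ := C.hyperplane_separation' (x₀ := y) hyK
  exact absurd (hy w hw) (not_le.2 hlt)

/-- Solvency cones are outer semicontinuous, also after taking closed convex hulls, at matrices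
whose polar cone has interior points. -/
lemma mem_solvencyCone_of_tendsto {ι : Type*} {l : Filter ι} [l.NeBot]
    {Q : ι → Matrix (Fin D) (Fin D) ℝ} {M : Matrix (Fin D) (Fin D) ℝ}
    (hQ : ∀ i, IsBidAskMatrix (Q i)) (hlim : Tendsto Q l (𝓝 M))
    {z : Vec D} (hz : z ∈ interior (polarCone M)) {y : Vec D}
    (hy : ∀ w, (∀ᶠ i in l, w ∈ polarCone (Q i)) → 0 ≤ (inner ℝ y w : ℝ)) :
    y ∈ solvencyCone M := by
  refine mem_solvencyCone_of_forall_polarCone (isClosed_solvencyCone hz) fun w hw => ?_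
  -- Moving `w` towards `z` makes its pairing with each nonzero generator of `K(M)` strictly
  -- positive, which survives a small change of the matrix; `ε → 0` then recovers `w`.
  have key : ∀ ε : ℝ, 0 < ε → 0 ≤ (inner ℝ y (w + ε • z) : ℝ) := by
    intro ε hε
    refine hy _ ?_
    simp only [mem_polarCone_iff, eventually_all]
    intro k
    -- The generators `π^{ii} e^i - e^i` vanish for all bid-ask matrices, so strict positivity fails
    -- for them but nothing is needed.
    by_cases hk : ∀ N : Matrix (Fin D) (Fin D) ℝ, IsBidAskMatrix N → solvencyGen N k = 0
    · exact Eventually.of_forall fun i => by simp [hk _ (hQ i)]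
    · have hk0 : solvencyGen M k ≠ 0 := by
        contrapose! hk
        intro N hN
        rcases k with i | ⟨i, j⟩
        · exact hk
        · have hij : i = j := by
            by_contra hij
            have := congrArg (fun v : Vec D => v j) hk
            simp [solvencyGen, Ne.symm hij] at this
          subst hij
          simp [solvencyGen, hN.diag]
      have hpos : 0 < (inner ℝ (solvencyGen M k) (w + ε • z) : ℝ) := by
        rw [inner_add_right, real_inner_smul_right]
        exact add_pos_of_nonneg_of_pos (hw _ (solvencyGen_mem M k))
          (mul_pos hε (inner_pos_of_mem_interior_polarCone hz (solvencyGen_mem M k) hk0))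
      have ht : Tendsto (fun i => (inner ℝ (solvencyGen (Q i) k) (w + ε • z) : ℝ)) l
          (𝓝 (inner ℝ (solvencyGen M k) (w + ε • z))) :=
        (((continuous_solvencyGen k).tendsto M).comp hlim).inner tendsto_const_nhds
      exact (ht.eventually_const_lt hpos).mono fun _ h => h.le
  have hc : Tendsto (fun ε : ℝ => (inner ℝ y (w + ε • z) : ℝ)) (𝓝[>] 0) (𝓝 (inner ℝ y w)) := by
    refine Tendsto.mono_left ?_ nhdsWithin_le_nhds
    have : Continuous fun ε : ℝ => (inner ℝ y (w + ε • z) : ℝ) := by fun_prop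
    simpa using this.tendsto 0
  exact ge_of_tendsto hc (eventually_mem_nhdsWithin.mono fun ε hε => key ε hε)

/-- Inner semicontinuity: with the coefficients kept fixed, the combination moves continuously with
the generators. -/
lemma solvencyCone_subset_of_tendsto {ι : Type*} {l : Filter ι} [l.NeBot]
    {Q : ι → Matrix (Fin D) (Fin D) ℝ} {M : Matrix (Fin D) (Fin D) ℝ} (hlim : Tendsto Q l (𝓝 M))
    {C : Set (Vec D)} (hC : IsClosed C) (hQ : ∀ᶠ i in l, solvencyCone (Q i) ⊆ C) :
    solvencyCone M ⊆ C := by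
  intro v hv
  obtain ⟨c, hc, rfl⟩ := mem_solvencyCone_iff.1 hv
  refine hC.mem_of_tendsto (f := fun i => ∑ k, c k • solvencyGen (Q i) k) (b := l)
    (tendsto_finsetSum _ fun k _ =>
      (((continuous_solvencyGen k).tendsto M).comp hlim).const_smul (c k))
    (hQ.mono fun i hi => hi (mem_solvencyCone_iff.2 ⟨c, hc, rfl⟩))

open scoped Pointwise in
/-- The closed convex hull of a set that is stable under doubling is stable under addition. -/
lemma add_mem_closure_convexHull {E : Type*} [NormedAddCommGroup E] [NormedSpace ℝ E] {S : Set E}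
    (hS : ∀ v ∈ S, (2 : ℝ) • v ∈ S) {x y : E} (hx : x ∈ closure (convexHull ℝ S))
    (hy : y ∈ closure (convexHull ℝ S)) : x + y ∈ closure (convexHull ℝ S) := by
  have hdouble : ∀ v ∈ closure (convexHull ℝ S), (2 : ℝ) • v ∈ closure (convexHull ℝ S) := by
    intro v hv
    refine map_mem_closure (f := fun v : E => (2 : ℝ) • v) (by fun_prop) hv fun u hu => ?_
    have : (2 : ℝ) • u ∈ (2 : ℝ) • convexHull ℝ S := smul_mem_smul_set hu
    rw [← convexHull_smul] at this
    refine convexHull_mono ?_ this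
    rintro _ ⟨v, hv, rfl⟩
    exact hS v hv
  -- The sum is twice the midpoint.
  have hmid := (convex_convexHull ℝ S).closure hx hy (a := 1 / 2) (b := 1 / 2)
    (by norm_num) (by norm_num) (by norm_num)
  have := hdouble _ hmid
  rwa [← smul_add, smul_smul, show (2 : ℝ) * (1 / 2) = 1 by norm_num, one_smul] at this

end Cones

/-! ### Liquidation sets and the attained maximum. -/

section Liquidation

variable {d D : ℕ}

lemma continuous_padZero : Continuous (padZero d D) := by
  refine (PiLp.continuous_toLp 2 _).comp (continuous_pi fun i => ?_)
  split_ifs with h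
  · fun_prop
  · fun_prop

lemma padZero_mem_orthant {ξ : Vec d} (hξ : ξ ∈ orthant d) : padZero d D ξ ∈ orthant D := by
  intro i
  simp only [padZero]
  split_ifs with h
  exacts [hξ _, le_rfl]

lemma projFirst_padZero (hdD : d ≤ D) (ξ : Vec d) : projFirst hdD (padZero d D ξ) = ξ := by
  ext i
  simp [projFirst, padZero]

lemma projFirst_mem_orthant (hdD : d ≤ D) {x : Vec D} (hx : x ∈ orthant D) :
    projFirst hdD x ∈ orthant d := fun i => hx (Fin.castLE hdD i)

lemma sub_padZero_projFirst_mem_orthant (hdD : d ≤ D) {x : Vec D} (hx : x ∈ orthant D) :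
    x - padZero d D (projFirst hdD x) ∈ orthant D := by
  intro i
  simp only [padZero, projFirst, PiLp.sub_apply]
  split_ifs with h
  · simp [Fin.castLE]
  · simpa using hx i

lemma isClosed_orthant (n : ℕ) : IsClosed (orthant n) := by
  simp only [orthant, ofPred_forall]
  exact isClosed_iInter fun i => isClosed_le continuous_const (by fun_prop)

lemma zero_mem_orthant (n : ℕ) : (0 : Vec n) ∈ orthant n := fun _ => le_rfl

lemma padZero_zero : padZero d D 0 = 0 := by
  ext i
  simp [padZero]

lemma zero_mem_liquidationSet {M : Matrix (Fin D) (Fin D) ℝ} {w : Vec D}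
    (hw : w ∈ solvencyCone M) : (0 : Vec d) ∈ liquidationSet d M w :=
  ⟨zero_mem_orthant d, by simpa [padZero_zero] using hw⟩

lemma mem_solvencyCone_of_mem_liquidationSet {M : Matrix (Fin D) (Fin D) ℝ} {w : Vec D}
    {ξ : Vec d} (h : ξ ∈ liquidationSet d M w) : w ∈ solvencyCone M := by
  have := add_mem_solvencyCone h.2
    (orthant_subset_solvencyCone M (padZero_mem_orthant (D := D) h.1))
  simpa using this

/-- Prices `z` in the interior are strictly positive and `⟨(ξ, 0), z⟩ ≤ ⟨w, z⟩`, so `ξ i` is at most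
the value of `w` divided by the price of good `i`. -/
lemma isCompact_liquidationSet (hdD : d ≤ D) {M : Matrix (Fin D) (Fin D) ℝ} {z : Vec D}
    (hz : z ∈ interior (polarCone M)) (w : Vec D) : IsCompact (liquidationSet d M w) := by
  have hcl : IsClosed (liquidationSet d M w) :=
    (isClosed_orthant d).inter ((isClosed_solvencyCone hz).preimage
      (continuous_padZero.sub continuous_const).neg)
  have hz0 : ∀ i, 0 < z i := by
    intro i
    have := inner_pos_of_mem_interior_polarCone hz (solvencyGen_mem M (.inl i))
      (by simp [solvencyGen])
    simpa [solvencyGen, EuclideanSpace.inner_single_left] using this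
  set B : Fin d → ℝ := fun i => inner ℝ w z / z (Fin.castLE hdD i)
  have hcomp : IsCompact ((WithLp.toLp 2 : (Fin d → ℝ) → Vec d) '' Icc 0 B) :=
    isCompact_Icc.image (PiLp.continuous_toLp 2 _)
  refine hcomp.of_isClosed_subset hcl fun ξ hξ => ⟨ξ, ⟨hξ.1, fun i => ?_⟩, rfl⟩
  simp only [B]
  rw [le_div_iff₀ (hz0 _)]
  have h1 : (inner ℝ (padZero d D ξ) z : ℝ) ≤ inner ℝ w z := by
    have := interior_subset hz _ hξ.2
    rw [neg_sub, inner_sub_left] at this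
    linarith
  refine le_trans ?_ h1
  have h2 : (inner ℝ (padZero d D ξ) z : ℝ) = ∑ j, padZero d D ξ j * z j := by
    simp [PiLp.inner_apply, mul_comm]
  rw [h2]
  have h3 := Finset.single_le_sum (f := fun j => padZero d D ξ j * z j)
    (fun j _ => mul_nonneg (padZero_mem_orthant (D := D) hξ.1 j) (hz0 j).le)
    (Finset.mem_univ (Fin.castLE hdD i))
  simpa [padZero] using h3

lemma exists_eq_liquidationUtility (hdD : d ≤ D) {U : Vec d → EReal}
    (hU : UpperSemicontinuous U) {M : Matrix (Fin D) (Fin D) ℝ} {z : Vec D}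
    (hz : z ∈ interior (polarCone M)) {w : Vec D} (hw : w ∈ solvencyCone M) :
    ∃ ξ ∈ liquidationSet d M w, liquidationUtility U M w = U ξ := by
  obtain ⟨ξ, hξ, hmax⟩ := (hU.upperSemicontinuousOn _).exists_isMaxOn
    ⟨0, zero_mem_liquidationSet hw⟩ (isCompact_liquidationSet hdD hz w)
  exact ⟨ξ, hξ, le_antisymm (iSup₂_le fun η hη => hmax hη) (le_iSup₂ (f := fun ξ _ => U ξ) ξ hξ)⟩

lemma liquidationUtility_eq_bot {U : Vec d → EReal} {M : Matrix (Fin D) (Fin D) ℝ} {w : Vec D}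
    (hw : w ∉ solvencyCone M) : liquidationUtility U M w = ⊥ := by
  refine le_bot_iff.1 (iSup₂_le fun ξ hξ => ?_)
  exact absurd (mem_solvencyCone_of_mem_liquidationSet hξ) hw

/-- Trading from `w` to `x` within the solvency cone, and then discarding the last assets, does not
yield more utility than liquidating `w`. -/
lemma extendUtility_le_liquidationUtility (hdD : d ≤ D) (U : Vec d → EReal)
    {M : Matrix (Fin D) (Fin D) ℝ} {w x : Vec D} (h : w - x ∈ solvencyCone M) :
    extendUtility hdD U x ≤ liquidationUtility U M w := by
  rw [extendUtility]
  split_ifs with hx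
  · refine le_iSup₂ (f := fun ξ _ => U ξ) (projFirst hdD x) ⟨projFirst_mem_orthant hdD hx, ?_⟩
    have := add_mem_solvencyCone h
      (orthant_subset_solvencyCone M (sub_padZero_projFirst_mem_orthant hdD hx))
    simpa using this
  · exact bot_le

lemma extendUtility_padZero (hdD : d ≤ D) (U : Vec d → EReal) {ξ : Vec d} (hξ : ξ ∈ orthant d) :
    extendUtility hdD U (padZero d D ξ) = U ξ := by
  rw [extendUtility, if_pos (padZero_mem_orthant hξ), projFirst_padZero]

end Liquidation

/-! ### Measurable selection of optimal liquidations. -/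

section Selection

/-- A measurable multifunction with non-empty compact values: the sets where it meets a given
closed set are measurable. -/
structure IsCompactCorrespondence {α Y : Type*} [MeasurableSpace α] [TopologicalSpace Y]
    (A : α → Set Y) : Prop where
  isCompact : ∀ a, IsCompact (A a)
  nonempty : ∀ a, (A a).Nonempty
  measurableSet_hit : ∀ C, IsClosed C → MeasurableSet {a | (A a ∩ C).Nonempty}

/-- The maximizers of `φ` in `S`. -/
def maximizers {Y : Type*} (φ : Y → EReal) (S : Set Y) : Set Y := {y ∈ S | IsMaxOn φ S y}

variable {α Y : Type*} [MeasurableSpace α] [TopologicalSpace Y] {A : α → Set Y}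

lemma IsCompactCorrespondence.maximizers [T2Space Y] (hA : IsCompactCorrespondence A)
    {φ : Y → EReal} (hφ : UpperSemicontinuous φ) :
    IsCompactCorrespondence fun a => maximizers φ (A a) where
  nonempty a :=
    let ⟨y, hy, hmax⟩ := (hφ.upperSemicontinuousOn _).exists_isMaxOn (hA.nonempty a) (hA.isCompact a)
    ⟨y, hy, hmax⟩
  isCompact a := by
    obtain ⟨y, hy, hmax⟩ :=
      (hφ.upperSemicontinuousOn _).exists_isMaxOn (hA.nonempty a) (hA.isCompact a)
    have : _root_.maximizers φ (A a) = A a ∩ φ ⁻¹' Ici (φ y) := by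
      ext z
      refine ⟨fun hz => ⟨hz.1, hz.2 hy⟩, fun hz => ⟨hz.1, fun w hw => ?_⟩⟩
      exact le_trans (show φ w ≤ φ y from hmax hw) hz.2
    rw [this]
    exact (hA.isCompact a).inter_right (hφ.isClosed_preimage _)
  measurableSet_hit C hC := by
    -- Some maximizer lies in `C` iff the maximum over `A a ∩ C` is as large as over `A a`; this is
    -- tested at rational levels, whose superlevel sets are closed.
    have : {a | (_root_.maximizers φ (A a) ∩ C).Nonempty} = {a | (A a ∩ C).Nonempty} ∩
        ⋂ q : ℚ, ({a | (A a ∩ φ ⁻¹' Ici (((q : ℝ)) : EReal)).Nonempty}ᶜ ∪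
          {a | (A a ∩ (C ∩ φ ⁻¹' Ici (((q : ℝ)) : EReal))).Nonempty}) := by
      ext a
      constructor
      · rintro ⟨y, ⟨hy, hmax⟩, hyC⟩
        refine ⟨⟨y, hy, hyC⟩, mem_iInter.2 fun q => or_iff_not_imp_left.2 fun h => ?_⟩
        obtain ⟨y', hy', hq⟩ := not_not.1 h
        have hle : φ y' ≤ φ y := hmax hy'
        exact ⟨y, hy, hyC, mem_Ici.2 ((mem_Ici.1 hq).trans hle)⟩
      · rintro ⟨hne, hq⟩
        obtain ⟨y, hy, hmax⟩ := (hφ.upperSemicontinuousOn _).exists_isMaxOn hne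
          ((hA.isCompact a).inter_right hC)
        refine ⟨y, ⟨hy.1, fun y' hy' => ?_⟩, hy.2⟩
        by_contra hlt
        obtain ⟨q, hq1, hq2⟩ := EReal.lt_iff_exists_rat_btwn.1 (not_le.1 hlt)
        obtain ⟨z, hz, hzC, hzq⟩ :=
          (mem_iInter.1 hq q).resolve_left (not_not.2 ⟨y', hy', hq2.le⟩)
        exact absurd (hmax ⟨hz, hzC⟩) (not_le.2 (hq1.trans_le hzq))
    rw [this]
    exact (hA.measurableSet_hit C hC).inter (MeasurableSet.iInter fun q =>
      (hA.measurableSet_hit _ (hφ.isClosed_preimage _)).compl.union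
        (hA.measurableSet_hit _ (hC.inter (hφ.isClosed_preimage _))))

/-- Lexicographic maximization: passing to the maximizers of each `φ i` in turn makes that function
constant on what remains. -/
lemma IsCompactCorrespondence.exists_subset_forall_eq [T2Space Y] (hA : IsCompactCorrespondence A)
    {ι : Type*} (s : Finset ι) (φ : ι → Y → EReal) (hφ : ∀ i, UpperSemicontinuous (φ i)) :
    ∃ B : α → Set Y, IsCompactCorrespondence B ∧ (∀ a, B a ⊆ A a) ∧
      ∀ a, ∀ y ∈ B a, ∀ z ∈ B a, ∀ i ∈ s, φ i y = φ i z := by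
  classical
  induction s using Finset.induction_on with
  | empty => exact ⟨A, hA, fun _ => Subset.rfl, by simp⟩
  | insert i s _ ih =>
    obtain ⟨B, hB, hBA, hs⟩ := ih
    refine ⟨_, hB.maximizers (hφ i), fun a y hy => hBA a hy.1, fun a y hy z hz j hj => ?_⟩
    rcases Finset.mem_insert.1 hj with rfl | hj
    · exact le_antisymm (hz.2 hy.1) (hy.2 hz.1)
    · exact hs a y hy.1 z hz.1 j hj

/-- A measurable compact-valued multifunction in a Euclidean space has a measurable selection. -/
lemma IsCompactCorrespondence.exists_measurable_selection {n : ℕ} {A : α → Set (Vec n)}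
    (hA : IsCompactCorrespondence A) : ∃ ξ : α → Vec n, Measurable ξ ∧ ∀ a, ξ a ∈ A a := by
  -- With the coordinates as objectives, the remaining sets are singletons.
  obtain ⟨B, hB, hBA, heq⟩ := hA.exists_subset_forall_eq Finset.univ
    (fun (i : Fin n) (y : Vec n) => ((y i : ℝ) : EReal))
    (fun i => (continuous_coe_real_ereal.comp (by fun_prop)).upperSemicontinuous)
  choose ξ hξ using hB.nonempty
  refine ⟨ξ, measurable_of_isClosed fun C hC => ?_, fun a => hBA a (hξ a)⟩
  convert hB.measurableSet_hit C hC using 1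
  ext a
  refine ⟨fun h => ⟨ξ a, hξ a, h⟩, fun ⟨y, hy, hyC⟩ => ?_⟩
  have : ξ a = y := by
    ext i
    exact EReal.coe_injective (heq a _ (hξ a) _ hy i (Finset.mem_univ i))
  rwa [mem_preimage, this]

/-- Including the cone coefficients as variables makes the constraint closed in a finite-dimensional
space. Its projection to (matrix, portfolio) is then σ-compact, hence Borel. -/
lemma measurableSet_liquidationSet_inter_nonempty {d D : ℕ} {M : α → Matrix (Fin D) (Fin D) ℝ}
    (hM : StronglyMeasurable M) {w : α → Vec D} (hw : Measurable w) {C : Set (Vec d)}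
    (hC : IsClosed C) : MeasurableSet {a | (liquidationSet d (M a) (w a) ∩ C).Nonempty} := by
  let F : Set (((Fin D → Fin D → ℝ) × Vec D) × Vec d × (Fin D ⊕ (Fin D × Fin D) → ℝ)) :=
    {p | (p.2.1 ∈ orthant d ∩ C ∧ 0 ≤ p.2.2) ∧
      ∑ k, p.2.2 k • solvencyGen (Matrix.of p.1.1) k = -(padZero d D p.2.1 - p.1.2)}
  have hF : IsClosed F := by
    refine IsClosed.inter (IsClosed.inter ?_ ?_) ?_
    · exact ((isClosed_orthant d).inter hC).preimage (continuous_fst.comp continuous_snd)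
    · exact isClosed_le continuous_const (continuous_snd.comp continuous_snd)
    · refine isClosed_eq (continuous_finsetSum _ fun k _ => ?_) ?_
      · exact (by fun_prop : Continuous fun p : ((Fin D → Fin D → ℝ) × Vec D) × Vec d × (Fin D ⊕ (Fin D × Fin D) → ℝ) =>
          p.2.2 k).smul ((continuous_solvencyGen k).comp
            (by fun_prop : Continuous fun p : ((Fin D → Fin D → ℝ) × Vec D) × Vec d × (Fin D ⊕ (Fin D × Fin D) → ℝ) =>
              (p.1.1 : Matrix (Fin D) (Fin D) ℝ)))
      · exact ((continuous_padZero.comp (by fun_prop)).sub (by fun_prop)).neg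
  have himg : MeasurableSet (Prod.fst '' F) := by
    obtain ⟨K, hK, hKF⟩ := (isSigmaCompact_univ.of_isClosed_subset hF (subset_univ F)).image
      continuous_fst
    rw [← hKF]
    exact MeasurableSet.iUnion fun n => (hK n).measurableSet
  have hmeas : Measurable fun a => ((fun i j => M a i j, w a) : (Fin D → Fin D → ℝ) × Vec D) := by
    refine Measurable.prodMk (measurable_pi_lambda _ fun i => measurable_pi_lambda _ fun j => ?_) hw
    exact ((continuous_id.matrix_elem i j).comp_stronglyMeasurable hM).measurable
  convert hmeas himg using 1
  ext a
  constructor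
  · rintro ⟨ξ, ⟨hξ, hK⟩, hξC⟩
    obtain ⟨c, hc, h⟩ := mem_solvencyCone_iff.1 hK
    refine ⟨((fun i j => M a i j, w a), ξ, c), ⟨⟨⟨hξ, hξC⟩, hc⟩, ?_⟩, rfl⟩
    exact h
  · rintro ⟨⟨⟨N, v⟩, ξ, c⟩, ⟨⟨⟨hξ, hξC⟩, hc⟩, h⟩, hNv⟩
    obtain ⟨hN, hv⟩ := Prod.mk.inj hNv
    refine ⟨ξ, ⟨hξ, mem_solvencyCone_iff.2 ⟨c, hc, ?_⟩⟩, hξC⟩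
    rw [← hv]
    convert h using 4
    exact hN.symm

lemma measurableSet_mem_solvencyCone {D : ℕ} {M : α → Matrix (Fin D) (Fin D) ℝ}
    (hM : StronglyMeasurable M) {w : α → Vec D} (hw : Measurable w) :
    MeasurableSet {a | w a ∈ solvencyCone (M a)} := by
  -- Liquidation into no goods at all is possible exactly for solvent portfolios.
  convert measurableSet_liquidationSet_inter_nonempty (d := 0) hM hw isClosed_univ using 1
  ext a
  exact ⟨fun h => ⟨0, zero_mem_liquidationSet h, mem_univ _⟩,
    fun ⟨ξ, hξ, _⟩ => mem_solvencyCone_of_mem_liquidationSet hξ⟩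

/-- Optimal liquidation can be carried out in a measurable way. -/
lemma exists_measurable_liquidation {d D : ℕ} (hdD : d ≤ D) {U : Vec d → EReal}
    (hU : UpperSemicontinuous U) {M : α → Matrix (Fin D) (Fin D) ℝ} (hM : StronglyMeasurable M)
    {w : α → Vec D} (hw : Measurable w) {G : Set α} (hG : MeasurableSet G)
    (hGz : ∀ a ∈ G, (interior (polarCone (M a))).Nonempty)
    (hGw : ∀ a ∈ G, w a ∈ solvencyCone (M a)) :
    ∃ ξ : α → Vec d, Measurable ξ ∧ (∀ a, ξ a ∈ orthant d) ∧ ∀ a ∈ G,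
      ξ a ∈ liquidationSet d (M a) (w a) ∧ liquidationUtility U (M a) (w a) = U (ξ a) := by
  classical
  have hA : IsCompactCorrespondence
      fun a => if a ∈ G then liquidationSet d (M a) (w a) else {(0 : Vec d)} := by
    refine ⟨fun a => ?_, fun a => ?_, fun C hC => ?_⟩
    · split_ifs with h
      · obtain ⟨z, hz⟩ := hGz a h
        exact isCompact_liquidationSet hdD hz _
      · exact isCompact_singleton
    · split_ifs with h
      · exact ⟨0, zero_mem_liquidationSet (hGw a h)⟩
      · exact singleton_nonempty 0
    · convert (hG.inter (measurableSet_liquidationSet_inter_nonempty hM hw hC)).union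
        (hG.compl.inter (MeasurableSet.const (0 ∈ C))) using 1
      ext a
      by_cases h : a ∈ G <;> simp [h, singleton_inter_nonempty]
  obtain ⟨ξ, hξ, hmem⟩ := (hA.maximizers hU).exists_measurable_selection
  refine ⟨ξ, hξ, fun a => ?_, fun a ha => ?_⟩
  · have := (hmem a).1
    split_ifs at this with h
    · exact this.1
    · rw [mem_singleton_iff.1 this]
      exact zero_mem_orthant d
  · have := hmem a
    simp only [if_pos ha] at this
    exact ⟨this.1, le_antisymm (iSup₂_le fun η hη => this.2 hη)
      (le_iSup₂ (f := fun ξ _ => U ξ) (ξ a) this.1)⟩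

end Selection

/-! ### Extended-valued expectations. -/

section Expectation

variable {Ω : Type*} [MeasurableSpace Ω] {P : Measure Ω}

lemma expectation_mono {f g : Ω → EReal} (h : ∀ᵐ ω ∂P, f ω ≤ g ω) :
    expectation P f ≤ expectation P g := by
  have hpos : ∫⁻ ω, (f ω).toENNReal ∂P ≤ ∫⁻ ω, (g ω).toENNReal ∂P :=
    lintegral_mono_ae (h.mono fun ω hω => EReal.toENNReal_le_toENNReal hω)
  have hneg : ∫⁻ ω, (-g ω).toENNReal ∂P ≤ ∫⁻ ω, (-f ω).toENNReal ∂P :=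
    lintegral_mono_ae (h.mono fun ω hω => EReal.toENNReal_le_toENNReal (EReal.neg_le_neg_iff.2 hω))
  rw [expectation, expectation]
  split_ifs with hf
  · exact le_rfl
  · exact bot_le
  · rename_i hg
    exact absurd (top_le_iff.1 (hg ▸ hneg)) hf
  · exact EReal.sub_le_sub (EReal.coe_ennreal_le_coe_ennreal_iff.2 hpos)
      (EReal.coe_ennreal_le_coe_ennreal_iff.2 hneg)

lemma expectation_eq_bot {f : Ω → EReal} {s : Set Ω} (hs : MeasurableSet s) (hPs : P s ≠ 0)
    (hf : ∀ ω ∈ s, f ω = ⊥) : expectation P f = ⊥ := by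
  refine if_pos (top_le_iff.1 ?_)
  calc (⊤ : ℝ≥0∞) = ∫⁻ _ in s, ⊤ ∂P := by simp [ENNReal.top_mul hPs]
    _ = ∫⁻ ω in s, (-f ω).toENNReal ∂P :=
      setLIntegral_congr_fun hs fun ω hω => by simp [hf ω hω]
    _ ≤ ∫⁻ ω, (-f ω).toENNReal ∂P := setLIntegral_le_lintegral s _

end Expectation

/-! ### Trading at the terminal time. -/

section Terminal

variable {Ω : Type*} [mΩ : MeasurableSpace Ω] {T : ℝ≥0} {D : ℕ}

lemma TimeInterval.bot_lt_top (hT : 0 < T) : (⊥ : TimeInterval T) < ⊤ := hT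

lemma TimeInterval.neBot_nhdsLT_top (hT : 0 < T) : (𝓝[<] (⊤ : TimeInterval T)).NeBot :=
  nhdsLT_neBot_of_exists_lt ⟨⊥, TimeInterval.bot_lt_top hT⟩

lemma TimeInterval.exists_seq_tendsto_top (hT : 0 < T) :
    ∃ u : ℕ → TimeInterval T, (∀ n, u n < ⊤) ∧ Tendsto u atTop (𝓝[<] ⊤) := by
  obtain ⟨u, -, hu, hlim⟩ := exists_seq_strictMono_tendsto' (TimeInterval.bot_lt_top hT)
  exact ⟨u, fun n => (hu n).2, tendsto_nhdsWithin_iff.2 ⟨hlim, .of_forall fun n => (hu n).2⟩⟩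

/-- If there is no new information at time `T`, then events known at time `T` are predictable when
they are placed at time `T`. -/
lemma measurableSet_predictable_singleton_top_prod (hT : 0 < T)
    {𝓕 : Filtration (TimeInterval T) mΩ}
    (h𝓕 : (⨆ (t : TimeInterval T) (_ : t < ⊤), 𝓕 t) = 𝓕 ⊤) {A : Set Ω}
    (hA : MeasurableSet[𝓕 ⊤] A) :
    MeasurableSet[𝓕.predictable] (({⊤} : Set (TimeInterval T)) ×ˢ A) := by
  obtain ⟨u, hu, hlim⟩ := TimeInterval.exists_seq_tendsto_top hT
  have base : ∀ t < (⊤ : TimeInterval T), ∀ B, MeasurableSet[𝓕 t] B →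
      MeasurableSet[𝓕.predictable] (({⊤} : Set (TimeInterval T)) ×ˢ B) := by
    intro t ht B hB
    have : ({⊤} : Set (TimeInterval T)) ×ˢ B = ⋂ n, Ioi (max t (u n)) ×ˢ B := by
      ext ⟨s, ω⟩
      simp only [mem_prod, mem_singleton_iff, mem_iInter, mem_Ioi]
      refine ⟨fun ⟨hs, hω⟩ n => ⟨hs ▸ max_lt ht (hu n), hω⟩, fun h => ⟨?_, (h 0).2⟩⟩
      by_contra hs
      obtain ⟨n, hn⟩ := ((tendsto_nhdsWithin_iff.1 hlim).1.eventually
        (eventually_gt_nhds (lt_top_iff_ne_top.2 hs))).exists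
      exact absurd ((le_max_right _ _).trans_lt (h n).1) hn.not_gt
    rw [this]
    exact MeasurableSet.iInter fun n =>
      measurableSet_predictable_Ioi_prod (𝓕.mono (le_max_left _ _) _ hB)
  -- The events `B` with `{T} × B` predictable form a σ-algebra containing `𝓕 t` for all `t < T`,
  -- hence `𝓕_{T-} = 𝓕_T`.
  let m : MeasurableSpace Ω :=
    { MeasurableSet' := fun B => MeasurableSet[𝓕.predictable] (({⊤} : Set (TimeInterval T)) ×ˢ B)
      measurableSet_empty := by simp
      measurableSet_compl := fun B hB => by
        have : ({⊤} : Set (TimeInterval T)) ×ˢ Bᶜ = ({⊤} ×ˢ univ) \ ({⊤} ×ˢ B) := by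
          ext ⟨s, ω⟩
          simp +contextual
        rw [this]
        exact (base ⊥ (TimeInterval.bot_lt_top hT) _ MeasurableSet.univ).diff hB
      measurableSet_iUnion := fun B hB => by
        rw [prod_iUnion]
        exact MeasurableSet.iUnion hB }
  have hle : (⨆ (t : TimeInterval T) (_ : t < ⊤), 𝓕 t) ≤ m := iSup₂_le fun t ht => base t ht
  exact hle A (h𝓕 ▸ hA)

lemma isStronglyPredictable_update_top (hT : 0 < T) {𝓕 : Filtration (TimeInterval T) mΩ}
    (h𝓕 : (⨆ (t : TimeInterval T) (_ : t < ⊤), 𝓕 t) = 𝓕 ⊤) {V : TimeInterval T → Ω → Vec D}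
    (hV : IsStronglyPredictable 𝓕 V) {X : Ω → Vec D} (hX : Measurable[𝓕 ⊤] X) :
    IsStronglyPredictable 𝓕 (Function.update V ⊤ X) := by
  have hV' : Measurable[𝓕.predictable] (Function.uncurry V) := hV.measurable
  suffices h : Measurable[𝓕.predictable] (Function.uncurry (Function.update V ⊤ X)) from
    h.stronglyMeasurable
  intro B hB
  have : Function.uncurry (Function.update V ⊤ X) ⁻¹' B =
      ({⊤} ×ˢ (X ⁻¹' B)) ∪ (Function.uncurry V ⁻¹' B \ ({⊤} ×ˢ univ)) := by
    ext ⟨t, ω⟩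
    by_cases ht : t = ⊤ <;> simp [Function.uncurry, ht]
  rw [this]
  exact (measurableSet_predictable_singleton_top_prod hT h𝓕 (hX hB)).union
    ((hV' hB).diff (measurableSet_predictable_singleton_top_prod hT h𝓕 MeasurableSet.univ))

/-- The total variation is that on `[0, T)` plus the jump at `T`, and only this finite jump changes.
-/
lemma boundedVariationOn_update_top (hT : 0 < T) {f : TimeInterval T → Vec D}
    (hf : BoundedVariationOn f univ) (b : Vec D) :
    BoundedVariationOn (Function.update f ⊤ b) univ := by
  have hne := TimeInterval.neBot_nhdsLT_top hT
  have heq : EqOn (Function.update f ⊤ b) f (Iio ⊤) := fun t ht =>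
    Function.update_of_ne (ne_of_lt ht) _ _
  have hlim : Tendsto (Function.update f ⊤ b) (𝓝[<] ⊤) (𝓝 (f.leftLim ⊤)) :=
    (hf.tendsto_leftLim ⊤).congr' (eventually_mem_nhdsWithin.mono fun t ht => (heq ht).symm)
  have h := eVariationOn.eVariationOn_on_inter_Iic_eq_Iio_add_edist
    (f := Function.update f ⊤ b) (s := univ) (a := ⊤) (l := f.leftLim ⊤) (by simpa using hne)
    (mem_univ _) (by simpa using hlim)
  simp only [univ_inter, Iic_top] at h
  rw [BoundedVariationOn, h, eVariationOn.congr heq]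
  exact ENNReal.add_ne_top.2 ⟨hf.mono (subset_univ _), edist_ne_top _ _⟩

variable {P : Measure Ω} {𝓕 : Filtration (TimeInterval T) mΩ}
  {Pi : TimeInterval T → Ω → Matrix (Fin D) (Fin D) ℝ}

lemma SatisfiesUsualConditions.measurableSet_of_ae (h𝓕 : SatisfiesUsualConditions 𝓕 P)
    {p : Ω → Prop} (hp : ∀ᵐ ω ∂P, p ω) (t : TimeInterval T) : MeasurableSet[𝓕 t] {ω | p ω} := by
  have := h𝓕.complete _ (ae_iff.1 hp)
  exact 𝓕.mono bot_le _ (MeasurableSet.of_compl this)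

lemma tendsto_price_top (hPi : IsBidAskProcess 𝓕 Pi) (hFinal : NoFinalJump 𝓕 P Pi) :
    ∀ᵐ ω ∂P, Tendsto (fun t => Pi t ω) (𝓝[<] ⊤) (𝓝 (Pi ⊤ ω)) := by
  filter_upwards [hFinal.price_eq] with ω hω
  have := tendsto_leftLim_of_tendsto (hPi.cadlag ω ⊤).2
  rwa [hω] at this

lemma IsStrictlyConsistentPriceProcess.terminal_mem_interior {Z : TimeInterval T → Ω → Vec D}
    (hZ : IsStrictlyConsistentPriceProcess 𝓕 P Pi Z) :
    ∀ᵐ ω ∂P, Z ⊤ ω ∈ interior (polarCone (Pi ⊤ ω)) :=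
  (hZ.strict _ (isStoppingTime_const 𝓕 ⊤)).mono fun _ h => h ⊤ rfl

lemma IsSelfFinancing.tendsto_leftLim {V : TimeInterval T → Ω → Vec D}
    (hV : IsSelfFinancing 𝓕 P Pi V) :
    ∀ᵐ ω ∂P, Tendsto (fun t => V t ω) (𝓝[<] ⊤) (𝓝 (Function.leftLim (fun t => V t ω) ⊤)) :=
  hV.finiteVariation.mono fun _ h => h.tendsto_leftLim ⊤

lemma inner_nonneg_of_mem_closure_convexHull {S : Set (Vec D)} {w y : Vec D}
    (hS : ∀ v ∈ S, 0 ≤ (inner ℝ v w : ℝ)) (hy : y ∈ closure (convexHull ℝ S)) :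
    0 ≤ (inner ℝ y w : ℝ) := by
  have hcl : IsClosed {v : Vec D | 0 ≤ (inner ℝ v w : ℝ)} :=
    isClosed_le continuous_const (by fun_prop)
  have hconv : Convex ℝ {v : Vec D | 0 ≤ (inner ℝ v w : ℝ)} := by
    intro a ha b hb r s hr hs _
    simp only [mem_ofPred_eq, inner_add_left, real_inner_smul_left] at *
    positivity
  exact closure_minimal (convexHull_min hS hconv) hcl hy

/-- The final trade of a self-financing portfolio process is available at the terminal prices. -/
lemma IsSelfFinancing.leftLim_sub_mem_solvencyCone (hT : 0 < T) (hPi : IsBidAskProcess 𝓕 Pi)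
    (hFinal : NoFinalJump 𝓕 P Pi) (hSCPS : ∃ Z, IsStrictlyConsistentPriceProcess 𝓕 P Pi Z)
    {V : TimeInterval T → Ω → Vec D} (hV : IsSelfFinancing 𝓕 P Pi V) :
    ∀ᵐ ω ∂P, Function.leftLim (fun t => V t ω) ⊤ - V ⊤ ω ∈ solvencyCone (Pi ⊤ ω) := by
  obtain ⟨Z, hZ⟩ := hSCPS
  obtain ⟨u, hu, hlim⟩ := TimeInterval.exists_seq_tendsto_top hT
  have := TimeInterval.neBot_nhdsLT_top hT
  -- The trade from `u n` to `T` uses only cones on `[u n, T)`, so a `w` polar to all `K_t` near `T`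
  -- pairs non-negatively with it.
  have hsf := ae_all_iff.2 fun n => hV.selfFinancing (fun _ => u n) (fun _ => ⊤)
    (isStoppingTime_const 𝓕 _) (isStoppingTime_const 𝓕 _) fun _ => le_top
  filter_upwards [hZ.terminal_mem_interior, tendsto_price_top hPi hFinal, hV.tendsto_leftLim, hsf]
    with ω hz hp hleft hsf
  refine mem_solvencyCone_of_tendsto (fun t => hPi.bidAsk t ω) hp hz fun w hw => ?_
  have hlimV : Tendsto (fun n => (inner ℝ (V (u n) ω - V ⊤ ω) w : ℝ)) atTop
      (𝓝 (inner ℝ (Function.leftLim (fun t => V t ω) ⊤ - V ⊤ ω) w)) :=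
    ((hleft.comp hlim).sub_const _).inner tendsto_const_nhds
  obtain ⟨s, hs, hsw⟩ := (mem_nhdsLT_iff_exists_Ioo_subset' (TimeInterval.bot_lt_top hT)).1 hw
  refine ge_of_tendsto hlimV ?_
  filter_upwards [(tendsto_nhdsWithin_iff.1 hlim).1.eventually (eventually_gt_nhds hs)] with n hn
  have h := hsf n
  rw [neg_sub] at h
  refine inner_nonneg_of_mem_closure_convexHull ?_ h
  rintro v (hv | rfl)
  · obtain ⟨t, ht, hvt⟩ := mem_iUnion₂.1 hv
    exact hsw ⟨hn.trans_le ht.1, ht.2⟩ v hvt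
  · simp

lemma two_smul_mem_iUnion_solvencyCone {ι : Type*} {Q : ι → Matrix (Fin D) (Fin D) ℝ} {s : Set ι} :
    ∀ v ∈ (⋃ t ∈ s, solvencyCone (Q t)) ∪ {0},
      (2 : ℝ) • v ∈ (⋃ t ∈ s, solvencyCone (Q t)) ∪ {0} := by
  rintro v (hv | rfl)
  · obtain ⟨t, ht, hvt⟩ := mem_iUnion₂.1 hv
    exact Or.inl (mem_iUnion₂.2 ⟨t, ht, smul_mem_solvencyCone zero_le_two hvt⟩)
  · exact Or.inr (smul_zero _)

/-- The final trade of an admissible portfolio process may be replaced by any trade that is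
available at the terminal prices and leads to a non-negative portfolio. -/
lemma IsAdmissible.update_top (hT : 0 < T) (hPi : IsBidAskProcess 𝓕 Pi)
    (hFinal : NoFinalJump 𝓕 P Pi) {V : TimeInterval T → Ω → Vec D} (hV : IsAdmissible 𝓕 P Pi V)
    {X : Ω → Vec D} (hX : Measurable[𝓕 ⊤] X) (hX0 : ∀ ω, X ω ∈ orthant D)
    (hXV : ∀ᵐ ω ∂P, Function.leftLim (fun t => V t ω) ⊤ - X ω ∈ solvencyCone (Pi ⊤ ω)) :
    IsAdmissible 𝓕 P Pi (Function.update V ⊤ X) where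
  predictable := isStronglyPredictable_update_top hT hFinal.filtration_eq hV.predictable hX
  finiteVariation := by
    filter_upwards [hV.finiteVariation] with ω hω
    convert boundedVariationOn_update_top hT hω (X ω) using 1
    ext t : 1
    by_cases ht : t = ⊤
    · subst ht; simp
    · simp [ht]
  selfFinancing σ τ hσ hτ hστ := by
    obtain ⟨u, hu, hlim⟩ := TimeInterval.exists_seq_tendsto_top hT
    have := TimeInterval.neBot_nhdsLT_top hT
    -- The maximum keeps the times ordered for every `ω`; where `σ ω < T` it eventually equals `u
    -- n`, and the limit gives the trade from `σ` to `T-`.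
    have hsf := ae_all_iff.2 fun n => hV.selfFinancing σ (fun ω => max (σ ω) (u n)) hσ
      (by simpa only [WithTop.coe_max] using hσ.max_const (u n)) fun _ => le_max_left _ _
    filter_upwards [hV.selfFinancing σ τ hσ hτ hστ, hsf, hXV, hV.tendsto_leftLim,
      tendsto_price_top hPi hFinal] with ω h1 h2 h3 hleft hp
    rcases (le_top : τ ω ≤ ⊤).lt_or_eq with hτT | hτT
    · rwa [Function.update_of_ne hτT.ne, Function.update_of_ne ((hστ ω).trans_lt hτT).ne]
    rcases (le_top : σ ω ≤ ⊤).lt_or_eq with hσT | hσT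
    · rw [hτT, Function.update_self, Function.update_of_ne hσT.ne]
      have hmem1 : Function.leftLim (fun t => V t ω) ⊤ - X ω ∈
          closure (convexHull ℝ ((⋃ t ∈ Ico (σ ω) ⊤, solvencyCone (Pi t ω)) ∪ {0})) := by
        refine solvencyCone_subset_of_tendsto hp isClosed_closure ?_ h3
        filter_upwards [Ico_mem_nhdsLT hσT] with t ht
        exact fun v hv => subset_closure (subset_convexHull ℝ _ (Or.inl (mem_iUnion₂.2 ⟨t, ht, hv⟩)))
      have hmem2 : V (σ ω) ω - Function.leftLim (fun t => V t ω) ⊤ ∈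
          closure (convexHull ℝ ((⋃ t ∈ Ico (σ ω) ⊤, solvencyCone (Pi t ω)) ∪ {0})) := by
        have hl : Tendsto (fun n => V (σ ω) ω - V (u n) ω) atTop
            (𝓝 (V (σ ω) ω - Function.leftLim (fun t => V t ω) ⊤)) :=
          (hleft.comp hlim).const_sub _
        refine isClosed_closure.mem_of_tendsto hl ?_
        filter_upwards [(tendsto_nhdsWithin_iff.1 hlim).1.eventually (eventually_gt_nhds hσT)]
          with n hn
        have h := h2 n
        rw [max_eq_right hn.le, neg_sub] at h
        refine closure_mono (convexHull_mono (union_subset_union_left _ ?_)) h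
        exact biUnion_subset_biUnion_left (Ico_subset_Ico_right le_top)
      convert add_mem_closure_convexHull two_smul_mem_iUnion_solvencyCone hmem1 hmem2 using 1
      abel
    · rw [hτT, hσT]
      simp
  bounded_below := by
    -- The old terminal bound is not needed: `X ≥ 0` suffices at `T`, and the old `a` still serves
    -- before `T`.
    obtain ⟨a, ha, -, hb⟩ := hV.bounded_below
    have hXa : ∀ ω, X ω + a • onesVec D ∈ orthant D := fun ω i => by
      simpa [onesVec] using add_nonneg (hX0 ω i) ha.le
    refine ⟨a, ha, .of_forall fun ω => ?_, fun τ hτ Z hZ => ?_⟩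
    · rw [Function.update_self]
      exact orthant_subset_solvencyCone _ (hXa ω)
    · filter_upwards [hb τ hτ Z hZ] with ω hω
      by_cases hτT : τ ω = ⊤
      · rw [hτT, Function.update_self, PiLp.inner_apply]
        refine Finset.sum_nonneg fun i _ => ?_
        rw [real_inner_eq_re_inner, RCLike.inner_apply]
        exact mul_nonneg ((hZ.mem_orthant ⊤ ω).1 i) (hXa ω i)
      · rwa [Function.update_of_ne hτT]

/-- The pre-terminal value agrees almost everywhere with a random variable that is known at the
terminal time. -/
lemma IsSelfFinancing.measurable_leftLim (hT : 0 < T) (h𝓕 : SatisfiesUsualConditions 𝓕 P)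
    {V : TimeInterval T → Ω → Vec D} (hV : IsSelfFinancing 𝓕 P Pi V) :
    ∃ W : Ω → Vec D, Measurable[𝓕 ⊤] W ∧
      ∀ᵐ ω ∂P, W ω = Function.leftLim (fun t => V t ω) ⊤ := by
  obtain ⟨u, hu, hlim⟩ := TimeInterval.exists_seq_tendsto_top hT
  set N : Set Ω := {ω | Tendsto (fun t => V t ω) (𝓝[<] ⊤)
    (𝓝 (Function.leftLim (fun t => V t ω) ⊤))}
  have hN : MeasurableSet[𝓕 ⊤] N := h𝓕.measurableSet_of_ae hV.tendsto_leftLim ⊤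
  -- Off `N` the left limit need not be a limit of the `V (u n)`; cutting it off there makes it a
  -- pointwise limit of measurable functions.
  refine ⟨N.indicator fun ω => Function.leftLim (fun t => V t ω) ⊤, ?_, ?_⟩
  · have hVn : ∀ n, Measurable[𝓕 ⊤] (V (u n)) := fun n =>
      (hV.predictable.stronglyAdapted (u n)).measurable.mono (𝓕.mono le_top) le_rfl
    refine @measurable_of_tendsto_metrizable _ _ (𝓕 ⊤) _ _ _ _ (fun n => N.indicator (V (u n))) _
      (fun n => (hVn n).indicator hN) (tendsto_pi_nhds.2 fun ω => ?_)
    by_cases hω : ω ∈ N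
    · simpa [hω, Function.comp_def] using Tendsto.comp hω hlim
    · simp [hω]
  · filter_upwards [hV.tendsto_leftLim] with ω hω
    exact indicator_of_mem (s := N) hω _

end Terminal

/-! ### The two inequalities. -/

theorem proposition4p2 {Ω : Type*} [mΩ : MeasurableSpace Ω] (P : Measure Ω)
    [IsProbabilityMeasure P] (T : ℝ≥0) (hT : 0 < T)
    (𝓕 : Filtration (TimeInterval T) mΩ) (h𝓕 : SatisfiesUsualConditions 𝓕 P)
    (d D : ℕ) (hd : 1 ≤ d) (hdD : d ≤ D)
    (Pi : TimeInterval T → Ω → Matrix (Fin D) (Fin D) ℝ) (hPi : IsBidAskProcess 𝓕 Pi)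
    (hFinal : NoFinalJump 𝓕 P Pi)
    (hSCPS : ∃ Z, IsStrictlyConsistentPriceProcess 𝓕 P Pi Z)
    (U : Vec d → EReal) (hU : IsInvestorUtility U) (x : Vec D) :
    -- the maximum that defines the liquidation utility is attained, for almost every `ω`
    (∀ᵐ ω ∂P, ∀ w ∈ solvencyCone (Pi ⊤ ω),
      ∃ ξ ∈ liquidationSet d (Pi ⊤ ω) w, liquidationUtility U (Pi ⊤ ω) w = U ξ) ∧
    valueFunction 𝓕 P Pi hdD U x =
      ⨆ W ∈ preTerminalPortfolios 𝓕 P Pi x,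
        expectation P fun ω => liquidationUtility U (Pi ⊤ ω) (W ω) := by
  have hint : ∀ᵐ ω ∂P, (interior (polarCone (Pi ⊤ ω))).Nonempty := by
    obtain ⟨Z, hZ⟩ := hSCPS
    exact hZ.terminal_mem_interior.mono fun ω h => ⟨_, h⟩
  refine ⟨hint.mono fun ω ⟨z, hz⟩ w hw =>
    exists_eq_liquidationUtility hdD hU.upperSemicontinuous hz hw, le_antisymm ?_ ?_⟩
  · refine iSup₂_le ?_
    rintro _ ⟨V, hV, rfl⟩
    refine le_iSup₂_of_le _ ⟨V, hV, rfl⟩ (expectation_mono ?_)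
    filter_upwards [hV.1.leftLim_sub_mem_solvencyCone hT hPi hFinal hSCPS] with ω hω
    exact extendUtility_le_liquidationUtility hdD U hω
  · refine iSup₂_le ?_
    rintro _ ⟨V, ⟨hV, hVx⟩, rfl⟩
    obtain ⟨W, hW, hWV⟩ := hV.measurable_leftLim hT h𝓕
    have hsolv : MeasurableSet[𝓕 ⊤] {ω | W ω ∈ solvencyCone (Pi ⊤ ω)} :=
      @measurableSet_mem_solvencyCone _ (𝓕 ⊤) _ _ (hPi.adapted ⊤) _ hW
    have hcongr : expectation P
          (fun ω => liquidationUtility U (Pi ⊤ ω) (Function.leftLim (fun t => V t ω) ⊤)) ≤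
        expectation P fun ω => liquidationUtility U (Pi ⊤ ω) (W ω) :=
      expectation_mono (hWV.mono fun ω hω => by rw [hω])
    refine hcongr.trans ?_
    by_cases hnull : P {ω | W ω ∈ solvencyCone (Pi ⊤ ω)}ᶜ = 0
    · have hgood := hint.and (ae_iff.2 hnull)
      obtain ⟨ξ, hξ, hξ0, hopt⟩ := @exists_measurable_liquidation _ (𝓕 ⊤) _ _ hdD _
        hU.upperSemicontinuous _ (hPi.adapted ⊤) _ hW _ (h𝓕.measurableSet_of_ae hgood ⊤)
        (fun ω hω => hω.1) (fun ω hω => hω.2)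
      have hadm : IsAdmissible 𝓕 P Pi (Function.update V ⊤ fun ω => padZero d D (ξ ω)) := by
        refine hV.update_top hT hPi hFinal (continuous_padZero.measurable.comp hξ)
          (fun ω => padZero_mem_orthant (hξ0 ω)) ?_
        filter_upwards [hgood, hWV] with ω hω hWω
        have := (hopt ω hω).1.2
        rwa [neg_sub, hWω] at this
      refine le_iSup₂_of_le _ ⟨_, ⟨hadm, ?_⟩, rfl⟩ (expectation_mono ?_)
      -- Since `T > 0`, changing the value at `T` leaves the initial endowment alone.
      · rwa [Function.update_of_ne (TimeInterval.bot_lt_top hT).ne]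
      · filter_upwards [hgood] with ω hω
        rw [Function.update_self, extendUtility_padZero hdD U (hξ0 ω)]
        exact (hopt ω hω).2.le
    · rw [expectation_eq_bot (𝓕.le ⊤ _ hsolv).compl hnull
        fun ω hω => liquidationUtility_eq_bot hω]
      exact bot_le
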